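/- Let $\mathbb{N}=\{1,2,\dots\}$. For finite sets $E,F\subset\mathbb{N}$ write $E<F$ if $\max E<\min F$. The Schreier families $S_\xi$, $\xi<\omega$, of finite subsets of $\mathbb{N}$ are defined by $S_0=\{\{n\}:n\in\mathbb{N}\}\cup\{\emptyset\}$ and $$S_{\xi+1}=\Big\{\bigcup_{i=1}^n F_i:\ n\in\mathbb{N},\ n\le\min F_1,\ F_1<\cdots<F_n,\ \emptyset\ne F_i\in S_\xi\ (i\le n)\Big\}\cup\{\emptyset\}.$$ The Schreier space $X^\xi$ is the completion of the space $c_{00}$ of finitely supported real sequences under the norm $\|x\|_\xi=\sup_{F\in S_\xi}\sum_{n\in F}|x(n)|$, and $(e_n^\xi)$ denotes its natural basis (the unit vectors of $c_{00}$). For $x=\sum_n a_ne_n^\xi\in X^\xi$ put $\|x\|_0=\sup_n|a_n|$. For an infinite set $M\subset\mathbb{N}$ let $X_M^\xi$ be the closed linear span of $(e_n^\xi)_{n\in M}$ in $X^\xi$. A sequence $(x_n)$ in a Banach space dominates a sequence $(y_n)$ in a Banach space if there is a constant $C>0$ such that $\|\sum_{i=1}^n a_iy_i\|\le C\|\sum_{i=1}^n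 a_ix_i\|$ for all $n\in\mathbb{N}$ and all real scalars $a_1,\dots,a_n$. **Theorem.** Let $\xi<\omega$ and let $L=\{l_1<l_2<\cdots\}$ and $M=\{m_1<m_2<\cdots\}$ be infinite subsets of $\mathbb{N}$. The following are equivalent: 1. There exist a bounded linear operator $T\colon X_L^\xi\to X_M^\xi$ and $\delta>0$ such that $\|T(e_l^\xi)\|_0>\delta$ for all $l\in L$. 2. $(e_{l_n}^\zeta)$ dominates $(e_{m_n}^\zeta)$ for every $\zeta\le\xi$. 3. $(e_{l_n}^\xi)$ dominates $(e_{m_n}^\xi)$. -/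

import Mathlib

open scoped BigOperators

noncomputable section

/-- The Schreier families `S_ξ`, `ξ < ω`, of finite subsets of the positive integers:
`S_0` consists of `∅` and the singletons, and a member of `S_{ξ+1}` is either empty or a union
`F_1 ∪ ⋯ ∪ F_n` of nonempty members of `S_ξ` with `n ≤ min F_1` and `F_1 < ⋯ < F_n`. -/
def schreierFamily : ℕ → Set (Finset ℕ+)
  | 0 => {F | ∃ n : ℕ+, F = {n}} ∪ {∅}
  | ξ + 1 =>
      {G | ∃ (n : ℕ) (F : Fin n → Finset ℕ+), 1 ≤ n ∧
          (∀ i, F i ∈ schreierFamily ξ ∧ (F i).Nonempty) ∧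
          (∀ i, ∀ a ∈ F i, n ≤ (a : ℕ)) ∧
          (∀ i j, i < j → ∀ a ∈ F i, ∀ b ∈ F j, a < b) ∧
          G = Finset.univ.biUnion F} ∪ {∅}

theorem empty_mem_schreierFamily (ξ : ℕ) : (∅ : Finset ℕ+) ∈ schreierFamily ξ := by
  cases ξ <;> exact Or.inr rfl

theorem singleton_mem_schreierFamily (ξ : ℕ) (n : ℕ+) : {n} ∈ schreierFamily ξ := by
  induction ξ with
  | zero => exact Or.inl ⟨n, rfl⟩
  | succ ξ ih =>
    refine Or.inl ⟨1, fun _ => {n}, le_rfl, fun _ => ⟨ih, Finset.singleton_nonempty n⟩,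
      fun _ a _ => a.pos, fun i j h => ?_, ?_⟩
    · exact absurd h (by rw [Subsingleton.elim i j]; exact lt_irrefl j)
    · ext a; simp

/-- The Schreier norm `‖x‖_ξ = sup_{F ∈ S_ξ} ∑_{n ∈ F} |x(n)|` of a finitely supported real
sequence. -/
def schreierNorm (ξ : ℕ) (x : ℕ+ →₀ ℝ) : ℝ :=
  ⨆ F : schreierFamily ξ, ∑ n ∈ F.1, |x n|

theorem sum_abs_le_sum_support (x : ℕ+ →₀ ℝ) (F : Finset ℕ+) :
    ∑ n ∈ F, |x n| ≤ ∑ n ∈ x.support, |x n| := by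
  classical
  calc ∑ n ∈ F, |x n| ≤ ∑ n ∈ F ∪ x.support, |x n| :=
        Finset.sum_le_sum_of_subset_of_nonneg Finset.subset_union_left
          fun _ _ _ => abs_nonneg _
    _ = ∑ n ∈ x.support, |x n| := by
        refine (Finset.sum_subset Finset.subset_union_right fun n _ hn => ?_).symm
        simpa using hn

theorem bddAbove_schreierNorm (ξ : ℕ) (x : ℕ+ →₀ ℝ) :
    BddAbove (Set.range fun F : schreierFamily ξ => ∑ n ∈ F.1, |x n|) :=
  ⟨∑ n ∈ x.support, |x n|, by rintro _ ⟨F, rfl⟩; exact sum_abs_le_sum_support x F.1⟩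

theorem sum_abs_le_schreierNorm {ξ : ℕ} (x : ℕ+ →₀ ℝ) {F : Finset ℕ+}
    (hF : F ∈ schreierFamily ξ) : ∑ n ∈ F, |x n| ≤ schreierNorm ξ x :=
  le_ciSup (bddAbove_schreierNorm ξ x) ⟨F, hF⟩

theorem schreierNorm_le {ξ : ℕ} {x : ℕ+ →₀ ℝ} {C : ℝ}
    (h : ∀ F ∈ schreierFamily ξ, ∑ n ∈ F, |x n| ≤ C) : schreierNorm ξ x ≤ C :=
  haveI : Nonempty (schreierFamily ξ) := ⟨⟨∅, empty_mem_schreierFamily ξ⟩⟩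
  ciSup_le fun F => h F.1 F.2

theorem abs_apply_le_schreierNorm (ξ : ℕ) (x : ℕ+ →₀ ℝ) (n : ℕ+) :
    |x n| ≤ schreierNorm ξ x := by
  simpa using sum_abs_le_schreierNorm x (singleton_mem_schreierFamily ξ n)

theorem schreierNorm_nonneg (ξ : ℕ) (x : ℕ+ →₀ ℝ) : 0 ≤ schreierNorm ξ x :=
  (abs_nonneg _).trans (abs_apply_le_schreierNorm ξ x 1)

/-- The space `c₀₀` of finitely supported real sequences indexed by the positive integers; the
index `ξ` records that it is normed by `‖·‖_ξ`. -/
def SchreierC00 (_ξ : ℕ) : Type := ℕ+ →₀ ℝ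

instance (ξ : ℕ) : AddCommGroup (SchreierC00 ξ) := inferInstanceAs (AddCommGroup (ℕ+ →₀ ℝ))

instance (ξ : ℕ) : Module ℝ (SchreierC00 ξ) := inferInstanceAs (Module ℝ (ℕ+ →₀ ℝ))

instance (ξ : ℕ) : Norm (SchreierC00 ξ) := ⟨fun x => schreierNorm ξ x⟩

theorem schreierC00_core (ξ : ℕ) : NormedSpace.Core ℝ (SchreierC00 ξ) where
  norm_nonneg x := schreierNorm_nonneg ξ x
  norm_smul c x := by
    have key : ∀ (c : ℝ) (x : ℕ+ →₀ ℝ), schreierNorm ξ (c • x) = |c| * schreierNorm ξ x := by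
      intro c x
      simp only [schreierNorm, Real.mul_iSup_of_nonneg (abs_nonneg c), Finsupp.smul_apply,
        smul_eq_mul, abs_mul, Finset.mul_sum]
    exact key c x
  norm_triangle x y := by
    have key : ∀ x y : ℕ+ →₀ ℝ,
        schreierNorm ξ (x + y) ≤ schreierNorm ξ x + schreierNorm ξ y := by
      intro x y
      refine schreierNorm_le fun F hF => ?_
      calc ∑ n ∈ F, |(x + y) n| ≤ ∑ n ∈ F, (|x n| + |y n|) :=
            Finset.sum_le_sum fun n _ => abs_add_le (x n) (y n)
        _ = ∑ n ∈ F, |x n| + ∑ n ∈ F, |y n| := Finset.sum_add_distrib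
        _ ≤ _ := add_le_add (sum_abs_le_schreierNorm x hF) (sum_abs_le_schreierNorm y hF)
    exact key x y
  norm_eq_zero_iff x := by
    have key : ∀ x : ℕ+ →₀ ℝ, schreierNorm ξ x = 0 ↔ x = 0 := by
      intro x
      constructor
      · intro h
        ext n
        have h1 := abs_apply_le_schreierNorm ξ x n
        rw [h] at h1
        simpa using h1
      · rintro rfl
        exact le_antisymm (schreierNorm_le fun F _ => by simp) (schreierNorm_nonneg ξ 0)
    exact key x

instance (ξ : ℕ) : NormedAddCommGroup (SchreierC00 ξ) :=
  NormedAddCommGroup.ofCore (schreierC00_core ξ)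

instance (ξ : ℕ) : NormedSpace ℝ (SchreierC00 ξ) :=
  NormedSpace.ofCore (schreierC00_core ξ)

/-- The Schreier space `X^ξ`: the completion of `c₀₀` under `‖·‖_ξ`. -/
abbrev SchreierSpace (ξ : ℕ) : Type := UniformSpace.Completion (SchreierC00 ξ)

/-- The `n`-th vector of the unit vector basis of `c₀₀`. -/
def schreierUnitVec (ξ : ℕ) (n : ℕ+) : SchreierC00 ξ := (Finsupp.single n 1 : ℕ+ →₀ ℝ)

/-- The `n`-th vector `e_n^ξ` of the natural basis of `X^ξ`. -/
def schreierBasis (ξ : ℕ) (n : ℕ+) : SchreierSpace ξ :=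
  (schreierUnitVec ξ n : UniformSpace.Completion (SchreierC00 ξ))

/-- The `n`-th coordinate functional on `c₀₀`, which has norm at most one for `‖·‖_ξ`. -/
def schreierC00Coord (ξ : ℕ) (n : ℕ+) : SchreierC00 ξ →L[ℝ] ℝ :=
  LinearMap.mkContinuous (Finsupp.lapply n : (ℕ+ →₀ ℝ) →ₗ[ℝ] ℝ) 1 fun x => by
    rw [one_mul]; exact abs_apply_le_schreierNorm ξ x n

/-- The `n`-th coordinate functional on `X^ξ`, i.e. the continuous extension of the one on `c₀₀`;
it sends `∑ a_k e_k^ξ` to `a_n`. -/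
def schreierCoord (ξ : ℕ) (n : ℕ+) : SchreierSpace ξ →L[ℝ] ℝ :=
  (schreierC00Coord ξ n).extend UniformSpace.Completion.toComplL

theorem schreierCoord_coe (ξ : ℕ) (n : ℕ+) (x : SchreierC00 ξ) :
    schreierCoord ξ n (x : UniformSpace.Completion (SchreierC00 ξ)) =
      (show ℕ+ →₀ ℝ from x) n :=
  ContinuousLinearMap.extend_eq (schreierC00Coord ξ n)
    UniformSpace.Completion.denseRange_coe
    (UniformSpace.Completion.isUniformInducing_coe (SchreierC00 ξ)) x

theorem schreierCoord_basis (ξ : ℕ) (n k : ℕ+) :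
    schreierCoord ξ n (schreierBasis ξ k) = if k = n then 1 else 0 := by
  rw [schreierBasis, schreierCoord_coe]
  exact Finsupp.single_apply

theorem abs_schreierCoord_le (ξ : ℕ) (n : ℕ+) (x : SchreierSpace ξ) :
    |schreierCoord ξ n x| ≤ ‖x‖ := by
  induction x using UniformSpace.Completion.induction_on with
  | hp => exact isClosed_le (schreierCoord ξ n).continuous.abs continuous_norm
  | ih x =>
    rw [schreierCoord_coe, UniformSpace.Completion.norm_coe]
    exact abs_apply_le_schreierNorm ξ x n

/-- `‖x‖_0 = sup_n |a_n|` for `x = ∑ a_n e_n^ξ` in `X^ξ`. -/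
def schreierSupNorm (ξ : ℕ) (x : SchreierSpace ξ) : ℝ := ⨆ n : ℕ+, |schreierCoord ξ n x|

/-- The supremum defining `‖x‖_0` is over a bounded set. -/
theorem bddAbove_schreierSupNorm (ξ : ℕ) (x : SchreierSpace ξ) :
    BddAbove (Set.range fun n : ℕ+ => |schreierCoord ξ n x|) :=
  ⟨‖x‖, by rintro _ ⟨n, rfl⟩; exact abs_schreierCoord_le ξ n x⟩

/-- `X_M^ξ`: the closed linear span in `X^ξ` of the vectors `e_n^ξ`, `n ∈ M`. -/
def schreierSubspace (ξ : ℕ) (M : Set ℕ+) : Submodule ℝ (SchreierSpace ξ) :=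
  (Submodule.span ℝ (schreierBasis ξ '' M)).topologicalClosure

/-- The vector `e_n^ξ`, `n ∈ M`, as an element of `X_M^ξ`. -/
def schreierSubBasis (ξ : ℕ) (M : Set ℕ+) (n : M) : schreierSubspace ξ M :=
  ⟨schreierBasis ξ n, Submodule.le_topologicalClosure _
    (Submodule.subset_span (Set.mem_image_of_mem _ n.2))⟩

/-- The sequence `(x_n)` dominates the sequence `(y_n)`: for some constant `C > 0`,
`‖∑_{i<n} a_i y_i‖ ≤ C ‖∑_{i<n} a_i x_i‖` for all `n` and all scalars `a_i`. -/
def Dominates {X Y : Type*} [NormedAddCommGroup X] [NormedSpace ℝ X]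
    [NormedAddCommGroup Y] [NormedSpace ℝ Y] (x : ℕ → X) (y : ℕ → Y) : Prop :=
  ∃ C : ℝ, 0 < C ∧ ∀ (n : ℕ) (a : ℕ → ℝ),
    ‖∑ i ∈ Finset.range n, a i • y i‖ ≤ C * ‖∑ i ∈ Finset.range n, a i • x i‖

end

/-! Everything is read off on indices: a set of indices is of order `d` for the weight `l` when its
image under `l` lies in `S_d`. Domination at order `ζ` follows once every index set of order `ζ` for
`m` is norming for `l`: on it the `ℓ₁` norm is at most a constant times the `l`-norm of order `ζ`.

Given an operator as in (1), choose for each `i` a coordinate `k i` at which the image of the `i`-th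
basis vector exceeds `δ`. Averaging over signs suppresses the other coordinates and shows that
preimages under `k` of `m`-sets of order `ξ` are norming for `l` (`preimageNorming_of_operator`).

This property passes to all lower orders (`PreimageNorming.descend`). If it failed at order `d`,
unit masses of tiny `l`-norm of order `d` could be placed far apart, so that their sum has large
mass but norm at most two at order `d + 1` (`exists_spread_mass`).

Finally `k` must be replaced by the identity (`PreimageNorming.ascend`). Order zero bounds the
fibres of `k`, so `k` may be taken injective. Split an `m`-set of order `d + 1` into blocks with
initial points `f i`. Where `f i ≤ k i`, the image under `k` is again of order `d + 1`, so the
hypothesis applies. Where `k i < f i`, injectivity leaves at most `v ≤ l v` indices in the block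
starting at `v`, and induction handles the set of initial points.

Conversely, domination at order `ξ` yields the operator sending the `n`-th basis vector of one
subspace to that of the other. -/

/-! ### Combinatorics of weighted Schreier families. -/

/-- The Schreier families on `ℕ` with respect to a weight `w`: a nonempty member of the family of
order `d + 1` splits into at most `w (min F)` successive members of the family of order `d`. -/
def IsSchreier (w : ℕ → ℕ) : ℕ → Finset ℕ → Prop
  | 0, F => F.card ≤ 1
  | d + 1, F => ∃ (p : ℕ) (g : ℕ → ℕ), (∀ a ∈ F, g a < p ∧ p ≤ w a) ∧ MonotoneOn g F ∧
      ∀ i, IsSchreier w d (F.filter (g · = i))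

namespace IsSchreier

variable {w : ℕ → ℕ}

theorem mono {d : ℕ} {F F' : Finset ℕ} (h : IsSchreier w d F) (hF : F' ⊆ F) :
    IsSchreier w d F' := by
  induction d generalizing F F' with
  | zero => exact (Finset.card_le_card hF).trans h
  | succ d ih =>
    obtain ⟨p, g, hg, hmon, hS⟩ := h
    exact ⟨p, g, fun a ha => hg a (hF ha), hmon.mono (by exact_mod_cast hF),
      fun i => ih (hS i) (Finset.filter_subset_filter _ hF)⟩

theorem empty (w : ℕ → ℕ) (d : ℕ) : IsSchreier w d ∅ := by
  induction d with
  | zero => simp [IsSchreier]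
  | succ d ih => exact ⟨0, fun _ => 0, by simp, fun _ _ _ _ _ => le_rfl, fun i => by simpa using ih⟩

theorem singleton (hw : ∀ i, 0 < w i) (d a : ℕ) : IsSchreier w d {a} := by
  induction d with
  | zero => simp [IsSchreier]
  | succ d ih =>
    exact ⟨1, fun _ => 0, by simpa using Nat.succ_le_of_lt (hw a),
      fun _ _ _ _ _ => le_rfl, fun i => ih.mono (Finset.filter_subset _ _)⟩

/-- A member of the family of order `d + 1` is a union of sets `f⁻¹(v)`, `v ∈ V`, with at most
`w v` elements, where `V` is of order `d`. -/
theorem exists_blocks {d : ℕ} {F : Finset ℕ} (h : IsSchreier w (d + 1) F) :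
    ∃ (V : Finset ℕ) (f : ℕ → ℕ), V ⊆ F ∧ IsSchreier w d V ∧ (∀ a ∈ F, f a ∈ V ∧ f a ≤ a) ∧
      ∀ v, (F.filter (f · = v)).card ≤ w v := by
  induction d generalizing F with
  | zero =>
    obtain ⟨p, g, hg, -, hS⟩ := h
    rcases F.eq_empty_or_nonempty with rfl | hne
    · exact ⟨∅, id, by simp, empty w 0, by simp, by simp⟩
    have hcard : F.card ≤ p := by
      calc F.card ≤ (Finset.range p).card :=
            Finset.card_le_card_of_injOn g (fun a ha => by simpa using (hg a ha).1)
              fun a ha b hb hab => Finset.card_le_one.1 (hS (g b)) a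
                (Finset.mem_filter.2 ⟨ha, hab⟩) b (Finset.mem_filter.2 ⟨hb, rfl⟩)
        _ = p := Finset.card_range p
    -- At the lowest order there is one block, represented by its minimum.
    refine ⟨{F.min' hne}, fun _ => F.min' hne, by simpa using F.min'_mem hne, by simp [IsSchreier],
      fun a ha => ⟨by simp, F.min'_le a ha⟩, fun v => ?_⟩
    by_cases hv : F.min' hne = v
    · subst hv
      exact (Finset.card_filter_le _ _).trans (hcard.trans (hg _ (F.min'_mem hne)).2)
    · simp [hv]
  | succ d ih =>
    obtain ⟨p, g, hg, hmon, hS⟩ := h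
    choose V f hVF hV hf hcard using fun i => ih (hS i)
    have hVg : ∀ {i v}, v ∈ V i → v ∈ F ∧ g v = i := fun hv => Finset.mem_filter.1 (hVF _ hv)
    have hfa : ∀ {a}, a ∈ F → f (g a) a ∈ V (g a) ∧ f (g a) a ≤ a := fun ha =>
      hf _ _ (Finset.mem_filter.2 ⟨ha, rfl⟩)
    -- The representatives of the successive pieces are united; `g` still separates them, giving the
    -- outer structure of order `d + 1`.
    refine ⟨F.filter fun v => v ∈ V (g v), fun a => f (g a) a, Finset.filter_subset _ _,
      ⟨p, g, fun a ha => hg a (Finset.mem_filter.1 ha).1,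
        hmon.mono (by exact_mod_cast Finset.filter_subset _ _), fun i => (hV i).mono ?_⟩,
      fun a ha => ⟨?_, (hfa ha).2⟩, fun v => (Finset.card_le_card ?_).trans (hcard (g v) v)⟩
    · intro v hv
      simp only [Finset.mem_filter] at hv
      exact hv.2 ▸ hv.1.2
    · have h1 := (hfa ha).1
      have h2 := hVg h1
      exact Finset.mem_filter.2 ⟨h2.1, by rw [h2.2]; exact h1⟩
    · intro a ha
      obtain ⟨haF, rfl⟩ := Finset.mem_filter.1 ha
      have h2 := (hVg (hfa haF).1).2
      simp only [Finset.mem_filter, h2, haF, and_self]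

theorem card_filter_lt_lt {H : Finset ℕ} {a b : ℕ} (ha : a ∈ H) (hab : a < b) :
    (H.filter (· < a)).card < (H.filter (· < b)).card := by
  refine Finset.card_lt_card ((Finset.ssubset_iff_of_subset fun x hx => ?_).2
    ⟨a, by simp [ha, hab], by simp⟩)
  simp only [Finset.mem_filter] at hx ⊢; exact ⟨hx.1, hx.2.trans hab⟩

/-- A converse to `exists_blocks`. Monotonicity of `f` carries the outer decomposition of `V` back
to `H`, and `f a ≤ a` with `w` monotone preserves the bounds on the number of pieces. -/
theorem of_monotoneOn_blocks (hw : Monotone w) {d : ℕ} {V H : Finset ℕ} (hV : IsSchreier w d V)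
    {f : ℕ → ℕ} (hmon : MonotoneOn f H) (hf : ∀ a ∈ H, f a ∈ V ∧ f a ≤ a)
    (hcard : ∀ v, (H.filter (f · = v)).card ≤ w v) : IsSchreier w (d + 1) H := by
  induction d generalizing V H with
  | zero =>
    -- All of `H` lies over a single point of `V`; it is cut into singletons by rank.
    refine ⟨H.card, fun a => (H.filter (· < a)).card, fun a ha => ⟨?_, ?_⟩, ?_, fun i => ?_⟩
    · exact Finset.card_lt_card (Finset.filter_ssubset.2 ⟨a, ha, lt_irrefl a⟩)
    · refine le_trans (le_of_eq ?_) ((hcard (f a)).trans (hw (hf a ha).2))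
      rw [Finset.filter_true_of_mem]
      exact fun b hb => Finset.card_le_one.1 hV _ (hf b hb).1 _ (hf a ha).1
    · exact fun a _ b _ hab => Finset.card_le_card fun x hx => by
        simp only [Finset.mem_filter] at hx ⊢; exact ⟨hx.1, hx.2.trans_le hab⟩
    · refine Finset.card_le_one.2 fun a ha b hb => ?_
      obtain ⟨haH, hai⟩ := Finset.mem_filter.1 ha
      obtain ⟨hbH, hbi⟩ := Finset.mem_filter.1 hb
      rcases lt_trichotomy a b with h | h | h
      · exact absurd (card_filter_lt_lt haH h) (not_lt.2 (hbi.trans hai.symm).le)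
      · exact h
      · exact absurd (card_filter_lt_lt hbH h) (not_lt.2 (hai.trans hbi.symm).le)
  | succ d ih =>
    obtain ⟨p, g, hg, hgmon, hS⟩ := hV
    refine ⟨p, g ∘ f, fun a ha => ⟨(hg _ (hf a ha).1).1, (hg _ (hf a ha).1).2.trans
      (hw (hf a ha).2)⟩, fun a ha b hb hab => hgmon (hf a ha).1 (hf b hb).1 (hmon ha hb hab),
      fun i => ih (hS i) (hmon.mono (by exact_mod_cast Finset.filter_subset _ _))
        (fun a ha => ?_) fun v => le_trans (Finset.card_le_card ?_) (hcard v)⟩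
    · obtain ⟨ha, hi⟩ := Finset.mem_filter.1 ha
      exact ⟨Finset.mem_filter.2 ⟨(hf a ha).1, hi⟩, (hf a ha).2⟩
    · exact Finset.filter_subset_filter _ (Finset.filter_subset _ _)

/-- If the number of elements of `H` up to `t` never exceeds the total weight of the elements of
`V` up to `t`, then `H` is one order above `V`. -/
theorem of_card_le (hw : Monotone w) {d : ℕ} {V H : Finset ℕ} (hV : IsSchreier w d V)
    (hcard : ∀ t, (H.filter (· ≤ t)).card ≤ ∑ v ∈ V.filter (· ≤ t), w v) :
    IsSchreier w (d + 1) H := by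
  classical
  set W : ℕ → ℕ := fun t => ∑ v ∈ V.filter (· ≤ t), w v with hW
  set r : ℕ → ℕ := fun a => (H.filter (· < a)).card with hr
  have hrW : ∀ a ∈ H, r a < W a := fun a ha => by
    refine lt_of_lt_of_le (Finset.card_lt_card ?_) (hcard a)
    refine (Finset.ssubset_iff_of_subset fun x hx => ?_).2 ⟨a, by simp [ha], by simp⟩
    simp only [Finset.mem_filter] at hx ⊢; exact ⟨hx.1, hx.2.le⟩
  have hrmono : Monotone r := fun a b hab => Finset.card_le_card fun x hx => by
    simp only [Finset.mem_filter] at hx ⊢; exact ⟨hx.1, hx.2.trans_le hab⟩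
  have hrinj : ∀ a ∈ H, ∀ b, a < b → r a < r b := fun a ha b hab => card_filter_lt_lt ha hab
  -- Greedy filling: each `v ∈ V` has `w v` places, and the element of rank `r a` takes the first
  -- one still free. The default `0` is never used on `H`.
  let f : ℕ → ℕ := fun a => if h : ∃ v, r a < W v then Nat.find h else 0
  have hfind : ∀ a ∈ H, r a < W (f a) ∧ (∀ v, v < f a → W v ≤ r a) ∧ f a ≤ a := fun a ha => by
    have h : ∃ v, r a < W v := ⟨a, hrW a ha⟩
    have hfa : f a = Nat.find h := dif_pos h
    rw [hfa]
    exact ⟨Nat.find_spec h, fun v hv => not_lt.1 (Nat.find_min h hv), Nat.find_min' h (hrW a ha)⟩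
  have hWlt : ∀ v, W v ≤ ∑ u ∈ V.filter (· < v), w u + w v := fun v => by
    calc W v ≤ ∑ u ∈ insert v (V.filter (· < v)), w u := by
          refine Finset.sum_le_sum_of_subset fun x hx => ?_
          simp only [Finset.mem_filter, Finset.mem_insert] at hx ⊢
          rcases hx.2.lt_or_eq with h | h
          · exact Or.inr ⟨hx.1, h⟩
          · exact Or.inl h
      _ = _ := by rw [Finset.sum_insert (by simp), add_comm]
  have hlt : ∀ a ∈ H, ∑ u ∈ V.filter (· < f a), w u ≤ r a := fun a ha => by
    rcases Nat.eq_zero_or_pos (f a) with h | h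
    · simp [h]
    · refine le_trans (le_of_eq ?_) ((hfind a ha).2.1 (f a - 1) (by omega))
      refine Finset.sum_congr (Finset.filter_congr fun x _ => ?_) fun _ _ => rfl
      omega
  refine hV.of_monotoneOn_blocks hw (f := f) (fun a ha b hb hab => ?_) (fun a ha => ⟨?_, ?_⟩)
    fun v => ?_
  · by_contra hlt'
    have h1 := (hfind a ha).2.1 _ (not_le.1 hlt')
    have h2 := (hfind b hb).1
    have h3 := hrmono hab
    omega
  · by_contra hfa
    have h1 := hlt a ha
    have h2 := (hfind a ha).1
    have h3 : W (f a) = ∑ u ∈ V.filter (· < f a), w u := by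
      refine Finset.sum_congr (Finset.filter_congr fun x hx => ?_) fun _ _ => rfl
      have : x ≠ f a := fun h => hfa (h ▸ hx)
      omega
    omega
  · exact (hfind a ha).2.2
  · have hmaps : Set.MapsTo r (H.filter (f · = v))
        (Finset.Ico (∑ u ∈ V.filter (· < v), w u) (∑ u ∈ V.filter (· < v), w u + w v)) := by
      intro a ha
      obtain ⟨haH, rfl⟩ := Finset.mem_filter.1 (Finset.mem_coe.1 ha)
      exact Finset.mem_coe.2 (Finset.mem_Ico.2
        ⟨hlt a haH, (hfind a haH).1.trans_le (hWlt _)⟩)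
    refine (Finset.card_le_card_of_injOn r hmaps fun a ha b hb hab => ?_).trans (by simp)
    have ha := (Finset.mem_filter.1 (Finset.mem_coe.1 ha)).1
    have hb := (Finset.mem_filter.1 (Finset.mem_coe.1 hb)).1
    rcases lt_trichotomy a b with h | h | h
    · exact absurd (hrinj a ha b h) (by omega)
    · exact h
    · exact absurd (hrinj b hb a h) (by omega)

/-- Moving points to the right only lowers the counts in initial segments, so `of_card_le` applies
even though `k` may scramble the order and the blocks. -/
theorem image_of_blocks (hw : Monotone w) {d : ℕ} {V H : Finset ℕ} (hV : IsSchreier w d V)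
    {f k : ℕ → ℕ} (hf : ∀ a ∈ H, f a ∈ V ∧ f a ≤ k a)
    (hcard : ∀ v ∈ V, (H.filter (f · = v)).card ≤ w v) : IsSchreier w (d + 1) (H.image k) := by
  classical
  refine hV.of_card_le hw fun t => ?_
  calc ((H.image k).filter (· ≤ t)).card ≤ ((H.filter (f · ≤ t)).image k).card := by
        refine Finset.card_le_card fun x hx => ?_
        obtain ⟨hx, hxt⟩ := Finset.mem_filter.1 hx
        obtain ⟨a, ha, rfl⟩ := Finset.mem_image.1 hx
        exact Finset.mem_image_of_mem _ (Finset.mem_filter.2 ⟨ha, (hf a ha).2.trans hxt⟩)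
    _ ≤ (H.filter (f · ≤ t)).card := Finset.card_image_le
    _ = ∑ v ∈ V.filter (· ≤ t), ((H.filter (f · ≤ t)).filter (f · = v)).card := by
        refine Finset.card_eq_sum_card_fiberwise fun a ha => ?_
        obtain ⟨ha, hat⟩ := Finset.mem_filter.1 (Finset.mem_coe.1 ha)
        exact Finset.mem_coe.2 (Finset.mem_filter.2 ⟨(hf a ha).1, hat⟩)
    _ ≤ ∑ v ∈ V.filter (· ≤ t), w v := by
        refine Finset.sum_le_sum fun v hv => le_trans (Finset.card_le_card ?_)
          (hcard v (Finset.mem_filter.1 hv).1)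
        exact Finset.filter_subset_filter _ (Finset.filter_subset _ _)

end IsSchreier

/-! ### Norming sets. -/

/-- The weighted Schreier norm of order `d` is `C`-equivalent from below to the `ℓ₁` norm on `G`. -/
def IsNorming (w : ℕ → ℕ) (d : ℕ) (C : ℝ) (G : Finset ℕ) : Prop :=
  ∀ (x : ℕ → ℝ) (B : ℝ), (∀ i, 0 ≤ x i) →
    (∀ A ⊆ G, IsSchreier w d A → ∑ i ∈ A, x i ≤ B) → ∑ i ∈ G, x i ≤ C * B

namespace IsNorming

variable {w : ℕ → ℕ} {d : ℕ}

theorem mono {C : ℝ} {G G' : Finset ℕ} (h : IsNorming w d C G) (hG : G' ⊆ G) :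
    IsNorming w d C G' := by
  classical
  intro x B hx hB
  have h1 := h (fun i => if i ∈ G' then x i else 0) B (fun i => by split_ifs <;> simp [hx])
    fun A _ hAS => by
      rw [← Finset.sum_filter]
      exact hB _ (fun i hi => (Finset.mem_filter.1 hi).2) (hAS.mono (Finset.filter_subset _ _))
  rw [← Finset.sum_filter, Finset.filter_mem_eq_inter, Finset.inter_eq_right.2 hG] at h1
  exact h1

theorem union {C C' : ℝ} {G G' : Finset ℕ} (h : IsNorming w d C G) (h' : IsNorming w d C' G') :
    IsNorming w d (C + C') (G ∪ G') := by
  classical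
  intro x B hx hB
  have h1 := h x B hx fun A hA => hB A (hA.trans Finset.subset_union_left)
  have h2 := h' x B hx fun A hA => hB A (hA.trans Finset.subset_union_right)
  have h3 := Finset.sum_union_inter (s₁ := G) (s₂ := G') (f := x)
  have h4 : 0 ≤ ∑ i ∈ G ∩ G', x i := Finset.sum_nonneg fun i _ => hx i
  linarith

/-- Singletons belong to every order, so each coordinate is bounded by the norm. -/
theorem of_card (hw : ∀ i, 0 < w i) (G : Finset ℕ) : IsNorming w d G.card G := by
  intro x B hx hB
  rw [← nsmul_eq_mul]
  exact Finset.sum_le_card_nsmul _ _ _ fun i hi => by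
    simpa using hB {i} (by simpa using hi) (IsSchreier.singleton hw d i)

theorem exists_of_not {K : ℝ} (hK : 0 < K) {G : Finset ℕ} (h : ¬ IsNorming w d K G) :
    ∃ x : ℕ → ℝ, (∀ i, 0 ≤ x i) ∧ ∑ i ∈ G, x i = 1 ∧
      ∀ A ⊆ G, IsSchreier w d A → K * ∑ i ∈ A, x i ≤ 1 := by
  unfold IsNorming at h
  push Not at h
  obtain ⟨x, B, hx, hB, hlt⟩ := h
  have hB0 : 0 ≤ B := by simpa using hB ∅ (by simp) (IsSchreier.empty w d)
  have hpos : 0 < ∑ i ∈ G, x i := lt_of_le_of_lt (by positivity) hlt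
  refine ⟨fun i => x i / ∑ j ∈ G, x j, fun i => div_nonneg (hx i) hpos.le, ?_, fun A hA hS => ?_⟩
  · rw [← Finset.sum_div, div_self hpos.ne']
  · rw [← Finset.sum_div, ← mul_div_assoc, div_le_one hpos]
    nlinarith [hB A hA hS]

end IsNorming

/-! ### Large mass with small Schreier norm. -/

/-- Concatenation of `R` far apart sets carrying unit mass of small norm of order `d`: the total
mass is `R`, while the norm of order `d + 1` is at most two. -/
theorem exists_spread_mass {w : ℕ → ℕ} (hw : Monotone w) {d : ℕ} {k : ℕ → ℕ}
    {P : Finset ℕ → Prop} (hP0 : P ∅)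
    (h : ∀ N : ℕ, 0 < N → ∃ (F G : Finset ℕ) (x : ℕ → ℝ), (∀ i ∈ F, N ≤ i) ∧ (∀ i ∈ G, N ≤ i) ∧
      P F ∧ (∀ i ∈ G, k i ∈ F) ∧ (∀ i, 0 ≤ x i) ∧ ∑ i ∈ G, x i = 1 ∧
      ∀ A ⊆ G, IsSchreier w d A → (N : ℝ) * ∑ i ∈ A, x i ≤ 1) (R : ℕ) :
    ∀ N : ℕ, 0 < N → ∃ (F G : Finset ℕ) (x : ℕ → ℝ) (g : ℕ → ℕ), (∀ i ∈ F, N ≤ i) ∧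
      (∀ i ∈ G, N ≤ i) ∧ (∀ i ∈ F, g i < R) ∧ MonotoneOn g F ∧ (∀ s, P (F.filter (g · = s))) ∧
      (∀ i ∈ G, k i ∈ F) ∧ (∀ i, 0 ≤ x i) ∧ ∑ i ∈ G, x i = R ∧
      (∀ A ⊆ G, IsSchreier w d A → (N : ℝ) * ∑ i ∈ A, x i ≤ 1) ∧
      ∀ A ⊆ G, IsSchreier w (d + 1) A → ∑ i ∈ A, x i ≤ 2 := by
  classical
  induction R with
  | zero =>
    intro N _
    refine ⟨∅, ∅, fun _ => 0, fun _ => 0, by simp, by simp, by simp, fun _ _ _ _ _ => le_rfl,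
      by simpa using hP0, by simp, by simp, by simp, by simp, by simp⟩
  | succ R ih =>
    intro N hN
    obtain ⟨F₁, G₁, x₁, hF₁, hG₁, hP₁, hk₁, hx₁, hs₁, hA₁⟩ := h (2 * N) (by omega)
    set b := F₁.sup id + G₁.sup id + 1 with hb
    have hbF : ∀ i ∈ F₁, i < b := fun i hi => by
      have : i ≤ F₁.sup id := Finset.le_sup (f := id) hi
      omega
    have hbG : ∀ i ∈ G₁, i < b := fun i hi => by
      have : i ≤ G₁.sup id := Finset.le_sup (f := id) hi
      omega
    -- The remaining masses start beyond `b`, and their norm of order `d` beats the weight of every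
    -- point of the first block. The summand `2 * N` keeps the total norm of order `d` below `1 /
    -- N`.
    set N' := 2 * N + b + w b with hN'
    obtain ⟨F₂, G₂, x₂, g, hF₂, hG₂, hgR, hgm, hP₂, hk₂, hx₂, hs₂, hA₂, hB₂⟩ :=
      ih N' (by omega)
    have hF12 : ∀ i ∈ F₁, ∀ j ∈ F₂, i < j := fun i hi j hj => by
      have := hbF i hi; have := hF₂ j hj; omega
    have hG12 : ∀ i ∈ G₁, ∀ j ∈ G₂, i < j := fun i hi j hj => by
      have := hbG i hi; have := hG₂ j hj; omega
    set x : ℕ → ℝ := fun i => if i ∈ G₁ then x₁ i else x₂ i with hxdef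
    have hx : ∀ i, 0 ≤ x i := fun i => by
      simp only [hxdef]; split_ifs
      exacts [hx₁ i, hx₂ i]
    have hx1 : ∀ A ⊆ G₁, ∑ i ∈ A, x i = ∑ i ∈ A, x₁ i := fun A hA =>
      Finset.sum_congr rfl fun i hi => if_pos (hA hi)
    have hx2 : ∀ A ⊆ G₂, ∑ i ∈ A, x i = ∑ i ∈ A, x₂ i := fun A hA =>
      Finset.sum_congr rfl fun i hi => if_neg fun h' => lt_irrefl i (hG12 i h' i (hA hi))
    have hsplit : ∀ A ⊆ G₁ ∪ G₂, ∑ i ∈ A, x i = ∑ i ∈ A ∩ G₁, x₁ i + ∑ i ∈ A ∩ G₂, x₂ i := by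
      intro A hA
      rw [← hx1 _ Finset.inter_subset_right, ← hx2 _ Finset.inter_subset_right,
        ← Finset.sum_union, ← Finset.inter_union_distrib_left, Finset.inter_eq_left.2 hA]
      exact Finset.disjoint_left.2 fun i hi hi' => lt_irrefl i
        (hG12 i (Finset.mem_inter.1 hi).2 i (Finset.mem_inter.1 hi').2)
    refine ⟨F₁ ∪ F₂, G₁ ∪ G₂, x, fun i => if i ∈ F₁ then 0 else g i + 1, ?_, ?_, ?_, ?_, ?_, ?_,
      hx, ?_, ?_, ?_⟩
    · intro i hi
      rcases Finset.mem_union.1 hi with hi | hi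
      · have := hF₁ i hi; omega
      · have := hF₂ i hi; omega
    · intro i hi
      rcases Finset.mem_union.1 hi with hi | hi
      · have := hG₁ i hi; omega
      · have := hG₂ i hi; omega
    · intro i hi
      show ite _ _ _ < R + 1
      split_ifs with h1
      · omega
      · have := hgR i ((Finset.mem_union.1 hi).resolve_left h1); omega
    · intro i hi j hj hij
      have hi := Finset.mem_union.1 (Finset.mem_coe.1 hi)
      have hj := Finset.mem_union.1 (Finset.mem_coe.1 hj)
      show ite _ _ _ ≤ ite _ _ _
      split_ifs with h1 h2 h2
      · exact le_rfl
      · omega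
      · exact absurd (hF12 j h2 i (hi.resolve_left h1)) (by omega)
      · exact Nat.succ_le_succ (hgm (hi.resolve_left h1) (hj.resolve_left h2) hij)
    · intro s
      have hnot : ∀ i ∈ F₂, i ∉ F₁ := fun i hi hi' => lt_irrefl i (hF12 i hi' i hi)
      rcases s with _ | s
      · convert hP₁ using 1
        ext i
        simp only [Finset.mem_filter, Finset.mem_union]
        constructor
        · rintro ⟨-, h2⟩
          by_contra h1
          simp [h1] at h2
        · intro h1
          simp [h1]
      · convert hP₂ s using 1
        ext i
        simp only [Finset.mem_filter, Finset.mem_union]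
        constructor
        · rintro ⟨h1, h2⟩
          by_cases h3 : i ∈ F₁
          · simp [h3] at h2
          · exact ⟨h1.resolve_left h3, by simpa [h3] using h2⟩
        · rintro ⟨h1, h2⟩
          simp [h1, hnot i h1, h2]
    · intro i hi
      rcases Finset.mem_union.1 hi with hi | hi
      · exact Finset.mem_union_left _ (hk₁ i hi)
      · exact Finset.mem_union_right _ (hk₂ i hi)
    · rw [hsplit _ subset_rfl, Finset.union_inter_cancel_left, Finset.union_inter_cancel_right,
        hs₁, hs₂]
      push_cast; ring
    · intro A hA hS
      rw [hsplit A hA]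
      have h1 := hA₁ (A ∩ G₁) Finset.inter_subset_right (hS.mono Finset.inter_subset_left)
      have h2 := hA₂ (A ∩ G₂) Finset.inter_subset_right (hS.mono Finset.inter_subset_left)
      have h3 : 0 ≤ ∑ i ∈ A ∩ G₂, x₂ i := Finset.sum_nonneg fun i _ => hx₂ i
      have h4 : (2 * N : ℝ) ≤ N' := by exact_mod_cast (by omega : 2 * N ≤ N')
      push_cast at h1
      nlinarith
    · intro A hA hS
      rw [hsplit A hA]
      have h1 : ∑ i ∈ A ∩ G₁, x₁ i ≤ 1 := hs₁ ▸ Finset.sum_le_sum_of_subset_of_nonneg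
        Finset.inter_subset_right fun i _ _ => hx₁ i
      rcases (A ∩ G₁).eq_empty_or_nonempty with he | ⟨a, ha⟩
      · rw [he, Finset.sum_empty, zero_add]
        exact hB₂ _ Finset.inter_subset_right (hS.mono Finset.inter_subset_left)
      -- A set meeting the first block has at most `w b ≤ N'` pieces, each catching at most `1 / N'`
      -- of the later mass: at most one in all, plus at most one from the first block.
      · obtain ⟨p, q, hq, -, hqS⟩ := hS
        have ha' := Finset.mem_inter.1 ha
        have hpN : p ≤ N' := by
          have := hw (hbG a ha'.2).le
          have := (hq a ha'.1).2
          omega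
        have h2 : (N' : ℝ) * ∑ i ∈ A ∩ G₂, x₂ i ≤ p := by
          rw [← Finset.sum_fiberwise_of_maps_to (s := A ∩ G₂) (t := Finset.range p) (g := q)
            fun i hi => Finset.mem_range.2 (hq i (Finset.mem_inter.1 hi).1).1, Finset.mul_sum]
          refine (Finset.sum_le_card_nsmul _ _ 1 fun s _ => hA₂ _
            ((Finset.filter_subset _ _).trans Finset.inter_subset_right)
            ((hqS s).mono (Finset.filter_subset_filter _ Finset.inter_subset_left))).trans ?_
          simp
        have h3 : (p : ℝ) ≤ N' := by exact_mod_cast hpN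
        have h4 : (0 : ℝ) < N' := by exact_mod_cast (by omega : 0 < N')
        have h5 : ∑ i ∈ A ∩ G₂, x₂ i ≤ 1 := by
          by_contra hcon
          nlinarith [not_le.1 hcon]
        linarith

/-- No infinite set is uniformly norming. -/
theorem exists_not_isNorming {w : ℕ → ℕ} (hw : Monotone w) (d : ℕ) {S : Set ℕ}
    (hS : S.Infinite) (N : ℕ) (hN : 0 < N) : ∃ (F : Finset ℕ) (x : ℕ → ℝ), (∀ i ∈ F, N ≤ i) ∧
      (∀ i ∈ F, i ∈ S) ∧ (∀ i, 0 ≤ x i) ∧ ∑ i ∈ F, x i = 1 ∧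
      ∀ A ⊆ F, IsSchreier w d A → (N : ℝ) * ∑ i ∈ A, x i ≤ 1 := by
  have hN' : (0 : ℝ) < N := by exact_mod_cast hN
  induction d generalizing N with
  | zero =>
    have h1 : (S \ Set.Iio N).Infinite := hS.sdiff (Set.finite_Iio N)
    obtain ⟨F, hF, hcard⟩ := h1.exists_subset_card_eq N
    refine ⟨F, fun _ => 1 / N, fun i hi => not_lt.1 (hF hi).2, fun i hi => (hF hi).1,
      fun _ => by positivity, by simp [hcard, hN'.ne'], fun A _ hA => ?_⟩
    rw [Finset.sum_const, nsmul_eq_mul]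
    have : (A.card : ℝ) ≤ 1 := by exact_mod_cast hA
    field_simp
    exact this
  | succ d ih =>
    -- Total mass `2 * N` against norm two gives norm `1 / N` after normalising.
    obtain ⟨F, G, x, g, hF, hG, -, -, hP, hGF, hx, hs, -, h2⟩ := exists_spread_mass hw (d := d)
      (k := id) (P := fun F => ∀ i ∈ F, i ∈ S) (by simp) (fun N hN => by
        obtain ⟨F, x, h1, h2, h3, h4, h5⟩ := ih N hN (by exact_mod_cast hN)
        exact ⟨F, F, x, h1, h1, h2, fun _ h => h, h3, h4, h5⟩) (2 * N) N hN
    have hR : (0 : ℝ) < (2 * N : ℕ) := by push_cast; positivity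
    refine ⟨G, fun i => x i / (2 * N : ℕ), hG, fun i hi => hP (g i) i
      (Finset.mem_filter.2 ⟨hGF i hi, rfl⟩), fun i => div_nonneg (hx i) hR.le, ?_,
      fun A hA hAS => ?_⟩
    · rw [← Finset.sum_div, hs, div_self hR.ne']
    · rw [← Finset.sum_div, ← mul_div_assoc, div_le_one hR]
      push_cast
      nlinarith [h2 A hA hAS]

/-! ### Changing the order of norming preimages, and removing `k`. -/

/-- The preimage under `k` of each member of the `m`-family of order `d` is norming for the
`l`-norm of order `d`, with constant `C`. -/
def PreimageNorming (l m : ℕ → ℕ) (k : ℕ → ℕ) (d : ℕ) (C : ℝ) : Prop :=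
  ∀ F, IsSchreier m d F → ∀ G : Finset ℕ, (∀ i ∈ G, k i ∈ F) → IsNorming l d C G

namespace PreimageNorming

variable {l m k : ℕ → ℕ} {d : ℕ} {C : ℝ}

/-- Singletons have every order, so an infinite fibre would be a uniformly norming infinite set,
against `exists_not_isNorming`. -/
theorem finite_fiber (hl : Monotone l) (hm : ∀ i, i < m i) (h : PreimageNorming l m k d C)
    (j : ℕ) : {i | k i = j}.Finite := by
  by_contra hinf
  obtain ⟨N, hN⟩ := exists_nat_gt (max C 0)
  have hN0 : (0 : ℝ) < N := (le_max_right _ _).trans_lt hN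
  obtain ⟨F, x, -, hF, hx, hs, hA⟩ := exists_not_isNorming hl d hinf N (by exact_mod_cast hN0)
  have h1 := h {j} (IsSchreier.singleton (fun i => (Nat.zero_le i).trans_lt (hm i)) d j) F
    (fun i hi => by simpa using hF i hi) x (1 / N) hx fun A hAF hAS => by
      rw [le_div_iff₀ hN0, mul_comm]; exact hA A hAF hAS
  rw [hs, mul_one_div, le_div_iff₀ hN0] at h1
  linarith [le_max_left C 0]

/-- If no constant works at order `d`, the failures can be pushed arbitrarily far out and
concatenated into a single violation at order `d + 1`. -/
theorem descend (hl : Monotone l) (hl' : ∀ i, i < l i) (hm : ∀ i, i < m i)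
    (h : PreimageNorming l m k (d + 1) C) : ∃ C', PreimageNorming l m k d C' := by
  classical
  by_contra hcon
  simp only [PreimageNorming, not_exists, not_forall] at hcon
  have hfar : ∀ N : ℕ, 0 < N → ∃ (F G : Finset ℕ) (x : ℕ → ℝ), (∀ i ∈ F, N ≤ i) ∧
      (∀ i ∈ G, N ≤ i) ∧ IsSchreier m d F ∧ (∀ i ∈ G, k i ∈ F) ∧ (∀ i, 0 ≤ x i) ∧
      ∑ i ∈ G, x i = 1 ∧ ∀ A ⊆ G, IsSchreier l d A → (N : ℝ) * ∑ i ∈ A, x i ≤ 1 := by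
    intro N hN
    have hfin : {i | i < N ∨ k i < N}.Finite := by
      refine (Set.finite_Iio N).union ?_
      refine ((Set.finite_Iio N).biUnion fun j _ => h.finite_fiber hl hm j).subset fun i hi => ?_
      exact Set.mem_biUnion (Set.mem_Iio.2 hi) rfl
    set E := hfin.toFinset
    -- The finite set `E` costs at most its cardinality, so failure with constant `N` survives
    -- outside it.
    obtain ⟨F, hF, G, hG, hnot⟩ := hcon (E.card + N)
    have hnot' : ¬ IsNorming l d N (G \ E) := fun hn => hnot
      (((IsNorming.of_card (fun i => (Nat.zero_le i).trans_lt (hl' i)) E).union hn).mono fun i hi =>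
        by by_cases hE : i ∈ E <;> simp [hE, hi])
    have hE : ∀ i ∈ G \ E, i ∈ G ∧ N ≤ i ∧ N ≤ k i := fun i hi => by
      simpa [E, not_or] using hi
    obtain ⟨x, hx, hs, hA⟩ := IsNorming.exists_of_not (by exact_mod_cast hN) hnot'
    exact ⟨F.filter (N ≤ ·), G \ E, x, by simp, fun i hi => (hE i hi).2.1,
      hF.mono (Finset.filter_subset _ _), fun i hi => Finset.mem_filter.2
        ⟨hG i (hE i hi).1, (hE i hi).2.2⟩, hx, hs, hA⟩
  -- The union of `R` sets beyond `R` has order `d + 1` for `m`; its preimage carries mass `R > 2 *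
  -- C` with norm at most two.
  obtain ⟨R, hR⟩ := exists_nat_gt (2 * C)
  obtain ⟨F, G, x, g, hF, -, hgR, hgm, hP, hGF, hx, hs, -, h2⟩ :=
    exists_spread_mass hl (IsSchreier.empty m d) hfar R (R + 1) (by omega)
  have h1 := h F ⟨R, g, fun a ha => ⟨hgR a ha, by have := hF a ha; have := hm a; omega⟩, hgm, hP⟩
    G hGF x 2 hx h2
  linarith

theorem descend_le (hl : Monotone l) (hl' : ∀ i, i < l i) (hm : ∀ i, i < m i)
    (h : PreimageNorming l m k d C) {e : ℕ} (he : e ≤ d) : ∃ C', PreimageNorming l m k e C' := by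
  induction d generalizing C with
  | zero => exact ⟨C, by rwa [Nat.le_zero.1 he]⟩
  | succ d ih =>
    rcases he.eq_or_lt with rfl | he
    · exact ⟨C, h⟩
    · obtain ⟨C', h'⟩ := h.descend hl hl' hm
      exact ih h' (Nat.lt_succ_iff.1 he)

theorem card_fiber_le (h : PreimageNorming l m k 0 C) {G : Finset ℕ} {j : ℕ}
    (hG : ∀ i ∈ G, k i = j) : (G.card : ℝ) ≤ C := by
  have h1 := h {j} (by simp [IsSchreier]) G (fun i hi => by simpa using hG i hi) (fun _ => 1) 1
    (fun _ => zero_le_one) fun A _ hA => by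
      simpa using (show (A.card : ℝ) ≤ 1 by exact_mod_cast hA)
  simpa using h1

/-- The blocks of `F` have representatives of order `d`; whether `k` moves an index before its
representative decides which hypothesis controls it. -/
theorem ascend_of_injOn (hl : Monotone l) (hl' : ∀ i, i < l i) (hm : Monotone m)
    (h : PreimageNorming l m k (d + 1) C) {C' : ℝ}
    (hC' : ∀ F, IsSchreier m d F → IsNorming l d C' F) {F : Finset ℕ}
    (hF : IsSchreier m (d + 1) F) (hk : Set.InjOn k F) : IsNorming l (d + 1) (C + C') F := by
  classical
  obtain ⟨V, f, hVF, hV, hf, hcard⟩ := hF.exists_blocks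
  have hgood : IsNorming l (d + 1) C (F.filter fun i => f i ≤ k i) := by
    refine h ((F.filter fun i => f i ≤ k i).image k) (hV.image_of_blocks hm (f := f)
      (fun a ha => ?_) fun v _ => (Finset.card_le_card ?_).trans (hcard v)) _
      fun i hi => Finset.mem_image_of_mem _ hi
    · obtain ⟨ha, hak⟩ := Finset.mem_filter.1 ha
      exact ⟨(hf a ha).1, hak⟩
    · exact Finset.filter_subset_filter _ (Finset.filter_subset _ _)
  have hbad : IsNorming l (d + 1) C' (F.filter fun i => k i < f i) := by
    set E := F.filter fun i => k i < f i with hE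
    have hEF : ∀ i ∈ E, i ∈ F ∧ k i < f i := fun i hi => Finset.mem_filter.1 hi
    intro x B hx hB
    rw [← Finset.sum_fiberwise_of_maps_to (t := V) (g := f) fun i hi => (hf i (hEF i hi).1).1]
    -- Each block's mass is collected at its representative, where the bound of order `d` applies; a
    -- set `A` of representatives then expands to a set of order `d + 1`.
    refine hC' V hV (fun v => ∑ i ∈ E.filter (f · = v), x i) B
      (fun v => Finset.sum_nonneg fun i _ => hx i) fun A hA hAS => ?_
    set H := E.filter fun i => f i ∈ A with hH
    have hHE : ∀ i ∈ H, i ∈ E ∧ f i ∈ A := fun i hi => Finset.mem_filter.1 hi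
    have hsum : ∑ v ∈ A, ∑ i ∈ E.filter (f · = v), x i = ∑ i ∈ H, x i := by
      rw [← Finset.sum_fiberwise_of_maps_to (s := H) (t := A) (g := f) fun i hi => (hHE i hi).2]
      refine Finset.sum_congr rfl fun v hv => Finset.sum_congr ?_ fun _ _ => rfl
      ext i
      simp only [hH, Finset.mem_filter]
      constructor
      · rintro ⟨h1, rfl⟩; exact ⟨⟨h1, hv⟩, rfl⟩
      · rintro ⟨⟨h1, -⟩, h2⟩; exact ⟨h1, h2⟩
    rw [hsum]
    refine hB H (Finset.filter_subset _ _) ?_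
    have := hAS.image_of_blocks hl (H := H) (f := f) (k := id)
      (fun a ha => ⟨(hHE a ha).2, (hf a (hEF a (hHE a ha).1).1).2⟩) fun v _ => ?_
    · simpa using this
    -- On the bad part `k` maps the block of `v` injectively below `v`.
    · calc (H.filter (f · = v)).card ≤ (Finset.range v).card := by
            refine Finset.card_le_card_of_injOn k (fun a ha => ?_) fun a ha b hb hab => ?_
            · obtain ⟨ha, rfl⟩ := Finset.mem_filter.1 (Finset.mem_coe.1 ‹_›)
              simpa using (hEF a (hHE a (Finset.mem_filter.1 (Finset.mem_coe.1 ‹_›)).1).1).2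
            · exact hk (hEF a (hHE a (Finset.mem_filter.1 (Finset.mem_coe.1 ha)).1).1).1
                (hEF b (hHE b (Finset.mem_filter.1 (Finset.mem_coe.1 hb)).1).1).1 hab
        _ = v := Finset.card_range v
        _ ≤ l v := (hl' v).le
  refine (hgood.union hbad).mono fun i hi => ?_
  rcases le_or_gt (f i) (k i) with h1 | h1 <;> simp [hi, h1]

theorem ascend (hl : Monotone l) (hl' : ∀ i, i < l i) (hm : Monotone m)
    (h : ∀ e ≤ d, ∃ C, PreimageNorming l m k e C) :
    ∃ C', ∀ F, IsSchreier m d F → IsNorming l d C' F := by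
  classical
  induction d with
  | zero =>
    refine ⟨1, fun F hF x B _ hB => ?_⟩
    rw [one_mul]
    exact hB F subset_rfl hF
  | succ d ih =>
    obtain ⟨C₀, h₀⟩ := h 0 (Nat.zero_le _)
    obtain ⟨C₁, h₁⟩ := h (d + 1) le_rfl
    obtain ⟨C₂, h₂⟩ := ih fun e he => h e (he.trans (Nat.le_succ d))
    obtain ⟨D, hD⟩ := exists_nat_gt C₀
    -- The number of earlier indices with the same `k`-value colours the indices with `D` colours,
    -- and `k` is injective on each colour.
    set c : ℕ → ℕ := fun i => ((Finset.range i).filter (k · = k i)).card with hc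
    refine ⟨D * (C₁ + C₂), fun F hF x B hx hB => ?_⟩
    have hcD : ∀ i ∈ F, c i ∈ Finset.range D := fun i _ => by
      have := h₀.card_fiber_le (G := (Finset.range i).filter (k · = k i)) (j := k i) (by simp)
      exact Finset.mem_range.2 (by exact_mod_cast this.trans_lt hD)
    have hclt : ∀ i j, i < j → k i = k j → c i < c j := fun i j hij hk => by
      refine Finset.card_lt_card ((Finset.ssubset_iff_of_subset fun a ha => ?_).2
        ⟨i, by simp [hij, hk], by simp⟩)
      simp only [Finset.mem_filter, Finset.mem_range] at ha ⊢
      exact ⟨ha.1.trans hij, ha.2.trans hk⟩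
    rw [← Finset.sum_fiberwise_of_maps_to hcD, mul_assoc]
    refine (Finset.sum_le_card_nsmul _ _ ((C₁ + C₂) * B) fun s _ => ?_).trans (by simp)
    refine h₁.ascend_of_injOn hl hl' hm h₂ (hF.mono (Finset.filter_subset _ _)) ?_ x B hx
      fun A hA => hB A (hA.trans (Finset.filter_subset _ _))
    intro i hi j hj hij
    have hi := (Finset.mem_filter.1 (Finset.mem_coe.1 hi)).2
    have hj := (Finset.mem_filter.1 (Finset.mem_coe.1 hj)).2
    rcases lt_trichotomy i j with h | h | h
    · exact absurd (hclt i j h hij) (by omega)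
    · exact h
    · exact absurd (hclt j i h hij.symm) (by omega)

end PreimageNorming

/-! ### Translation to Schreier spaces. -/

theorem isSchreier_of_forall_mem {l : ℕ → ℕ+} (hl : StrictMono l) {d : ℕ} {F : Finset ℕ+}
    (hF : F ∈ schreierFamily d) {A : Finset ℕ} (hA : ∀ i ∈ A, l i ∈ F) :
    IsSchreier (fun i => (l i : ℕ)) d A := by
  classical
  induction d generalizing F A with
  | zero =>
    refine Finset.card_le_one.2 fun a ha b hb => hl.injective ?_
    rcases hF with ⟨n, rfl⟩ | hF
    · rw [Finset.mem_singleton.1 (hA a ha), Finset.mem_singleton.1 (hA b hb)]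
    · rw [Set.mem_singleton_iff.1 hF] at hA
      simpa using hA a ha
  | succ d ih =>
    rcases hF with ⟨n, E, -, hE, hmin, hlt, rfl⟩ | hF
    · have hex : ∀ i ∈ A, ∃ j : Fin n, l i ∈ E j := fun i hi => by
        simpa using hA i hi
      choose j hj using hex
      refine ⟨n, fun i => if h : i ∈ A then (j i h : ℕ) else 0, fun a ha => ?_, ?_, fun s => ?_⟩
      · simp only [dif_pos ha]
        exact ⟨(j a ha).2, hmin _ _ (hj a ha)⟩
      · intro a ha b hb hab
        rw [Finset.mem_coe] at ha hb
        simp only [ha, hb, dif_pos]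
        by_contra hcon
        exact absurd (hlt (j b hb) (j a ha) (not_le.1 hcon) _ (hj b hb) _ (hj a ha))
          (not_lt.2 (hl.monotone hab))
      · by_cases hs : s < n
        · refine ih (hE ⟨s, hs⟩).1 fun i hi => ?_
          obtain ⟨hi, his⟩ := Finset.mem_filter.1 hi
          simp only [dif_pos hi] at his
          have : j i hi = ⟨s, hs⟩ := Fin.ext his
          exact this ▸ hj i hi
        · convert IsSchreier.empty _ d
          refine Finset.filter_eq_empty_iff.2 fun i hi => ?_
          simp only [dif_pos hi]
          have := (j i hi).2
          omega
    · rw [Set.mem_singleton_iff.1 hF] at hA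
      have : A = ∅ := Finset.eq_empty_of_forall_notMem fun i hi => by simpa using hA i hi
      exact this ▸ IsSchreier.empty _ _

theorem IsSchreier.image_mem_schreierFamily {l : ℕ → ℕ+} (hl : StrictMono l) {d : ℕ}
    {A : Finset ℕ} (hA : IsSchreier (fun i => (l i : ℕ)) d A) :
    A.image l ∈ schreierFamily d := by
  classical
  induction d generalizing A with
  | zero =>
    rcases A.eq_empty_or_nonempty with rfl | hne
    · exact Or.inr rfl
    · obtain ⟨a, rfl⟩ := Finset.card_eq_one.1 (le_antisymm hA hne.card_pos)
      exact Or.inl ⟨l a, by simp⟩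
  | succ d ih =>
    obtain ⟨p, g, hg, hmon, hS⟩ := hA
    rcases A.eq_empty_or_nonempty with rfl | hne
    · exact Or.inr rfl
    left
    -- Only the values taken by `g` are enumerated, since the pieces in `schreierFamily` must be
    -- nonempty.
    set e := (A.image g).orderEmbOfFin rfl with he
    have hmem : ∀ i, ∃ a ∈ A, g a = e i := fun i =>
      Finset.mem_image.1 ((A.image g).orderEmbOfFin_mem rfl i)
    refine ⟨(A.image g).card, fun i => (A.filter (g · = e i)).image l,
      (hne.image g).card_pos, fun i => ⟨ih (hS _), ?_⟩, fun i x hx => ?_,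
      fun i j hij x hx y hy => ?_, ?_⟩
    · obtain ⟨a, ha, hai⟩ := hmem i
      exact ⟨l a, Finset.mem_image_of_mem _ (Finset.mem_filter.2 ⟨ha, hai⟩)⟩
    · obtain ⟨a, ha, rfl⟩ := Finset.mem_image.1 hx
      refine le_trans ?_ (hg a (Finset.mem_filter.1 ha).1).2
      calc (A.image g).card ≤ (Finset.range p).card := Finset.card_le_card fun s hs => by
            obtain ⟨b, hb, rfl⟩ := Finset.mem_image.1 hs
            exact Finset.mem_range.2 (hg b hb).1
        _ = p := Finset.card_range p
    · obtain ⟨a, ha, rfl⟩ := Finset.mem_image.1 hx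
      obtain ⟨b, hb, rfl⟩ := Finset.mem_image.1 hy
      obtain ⟨ha, hai⟩ := Finset.mem_filter.1 ha
      obtain ⟨hb, hbj⟩ := Finset.mem_filter.1 hb
      refine hl (lt_of_not_ge fun hba => ?_)
      have h1 := hmon hb ha hba
      have h2 : e i < e j := e.strictMono hij
      omega
    · ext x
      simp only [Finset.mem_image, Finset.mem_biUnion, Finset.mem_univ, true_and,
        Finset.mem_filter]
      constructor
      · rintro ⟨a, ha, rfl⟩
        have : g a ∈ Set.range e := by
          rw [he, Finset.range_orderEmbOfFin]
          exact Finset.mem_coe.2 (Finset.mem_image_of_mem _ ha)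
        obtain ⟨i, hi⟩ := this
        exact ⟨i, a, ⟨ha, hi.symm⟩, rfl⟩
      · rintro ⟨i, a, ⟨ha, -⟩, rfl⟩
        exact ⟨a, ha, rfl⟩

theorem sum_abs_schreierCoord_le {ξ : ℕ} {F : Finset ℕ+} (hF : F ∈ schreierFamily ξ)
    (z : SchreierSpace ξ) : ∑ n ∈ F, |schreierCoord ξ n z| ≤ ‖z‖ := by
  induction z using UniformSpace.Completion.induction_on with
  | hp =>
    exact isClosed_le (continuous_finsetSum _ fun n _ => (schreierCoord ξ n).continuous.abs)
      continuous_norm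
  | ih x =>
    simp only [schreierCoord_coe, UniformSpace.Completion.norm_coe]
    exact sum_abs_le_schreierNorm _ hF

theorem schreierCoord_sum_basis (ξ : ℕ) (l : ℕ → ℕ+) (a : ℕ → ℝ) (G : Finset ℕ) (n : ℕ+) :
    schreierCoord ξ n (∑ i ∈ G, a i • schreierBasis ξ (l i)) =
      ∑ i ∈ G, if l i = n then a i else 0 := by
  simp [map_sum, schreierCoord_basis]

theorem norm_sum_basis_le {ξ : ℕ} {l : ℕ → ℕ+} (hl : StrictMono l) {a : ℕ → ℝ} {G : Finset ℕ}
    {B : ℝ} (h : ∀ A ⊆ G, IsSchreier (fun i => (l i : ℕ)) ξ A → ∑ i ∈ A, |a i| ≤ B) :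
    ‖∑ i ∈ G, a i • schreierBasis ξ (l i)‖ ≤ B := by
  classical
  have hcoe : ∑ i ∈ G, a i • schreierBasis ξ (l i) =
      ((∑ i ∈ G, a i • schreierUnitVec ξ (l i) : SchreierC00 ξ) :
        UniformSpace.Completion (SchreierC00 ξ)) := by
    have := map_sum (UniformSpace.Completion.toComplL (𝕜 := ℝ) (E := SchreierC00 ξ))
      (fun i => a i • schreierUnitVec ξ (l i)) G
    simp only [map_smul] at this
    exact this.symm
  have hcoord := fun n => schreierCoord_sum_basis ξ l a G n
  rw [hcoe] at hcoord ⊢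
  rw [UniformSpace.Completion.norm_coe]
  refine schreierNorm_le fun F hF => ?_
  calc _ = ∑ n ∈ F, |∑ i ∈ G, if l i = n then a i else 0| :=
        Finset.sum_congr rfl fun n _ => by rw [← hcoord, schreierCoord_coe]
    _ ≤ ∑ n ∈ F, ∑ i ∈ G, if l i = n then |a i| else 0 := by
        refine Finset.sum_le_sum fun n _ => (Finset.abs_sum_le_sum_abs _ _).trans
          (Finset.sum_le_sum fun i _ => ?_)
        split_ifs <;> simp
    _ = ∑ i ∈ G.filter (l · ∈ F), |a i| := by
        rw [Finset.sum_comm, Finset.sum_filter]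
        simp
    _ ≤ B := h _ (Finset.filter_subset _ _)
        (isSchreier_of_forall_mem hl hF fun i hi => (Finset.mem_filter.1 hi).2)

theorem sum_abs_le_norm_sum_basis {ξ : ℕ} {l : ℕ → ℕ+} (hl : StrictMono l) (a : ℕ → ℝ)
    {G A : Finset ℕ} (hAG : A ⊆ G) (hA : IsSchreier (fun i => (l i : ℕ)) ξ A) :
    ∑ i ∈ A, |a i| ≤ ‖∑ i ∈ G, a i • schreierBasis ξ (l i)‖ := by
  classical
  refine le_trans (le_of_eq ?_) (sum_abs_schreierCoord_le (hA.image_mem_schreierFamily hl) _)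
  rw [Finset.sum_image fun _ _ _ _ h => hl.injective h]
  refine Finset.sum_congr rfl fun j hj => ?_
  rw [schreierCoord_sum_basis]
  simp [hl.injective.eq_iff, hAG hj]

theorem dominates_of_isNorming {ζ : ℕ} {l m : ℕ → ℕ+} (hl : StrictMono l) (hm : StrictMono m)
    {C : ℝ} (h : ∀ F, IsSchreier (fun i => (m i : ℕ)) ζ F →
      IsNorming (fun i => (l i : ℕ)) ζ C F) :
    Dominates (fun n => schreierBasis ζ (l n)) (fun n => schreierBasis ζ (m n)) := by
  refine ⟨max C 1, lt_max_of_lt_right one_pos, fun n a => norm_sum_basis_le hm fun A hA hS => ?_⟩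
  refine (h A hS (fun i => |a i|) _ (fun i => abs_nonneg _) fun E hE hES =>
    sum_abs_le_norm_sum_basis hl a (hE.trans hA) hES).trans ?_
  exact mul_le_mul_of_nonneg_right (le_max_left _ _) (norm_nonneg _)

/-! ### Sign averaging and operators. -/

/-- Averages over signs dominate the constant term. -/
theorem le_sum_powerset_abs {ι : Type*} [DecidableEq ι] (f : ι → ℝ) (F : Finset ι) (c : ℝ) :
    2 ^ F.card * |c| ≤
      ∑ U ∈ F.powerset, |c + ∑ j ∈ F, (if j ∈ U then 1 else -1) * f j| := by
  induction F using Finset.induction_on generalizing c with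
  | empty => simp
  | insert j F hj ih =>
    rw [Finset.sum_powerset_insert hj, Finset.card_insert_of_notMem hj]
    have h1 : ∀ U ∈ F.powerset, c + ∑ i ∈ insert j F, (if i ∈ U then 1 else -1) * f i =
        (c - f j) + ∑ i ∈ F, (if i ∈ U then 1 else -1) * f i := fun U hU => by
      rw [Finset.sum_insert hj, if_neg fun h => hj (Finset.mem_powerset.1 hU h)]
      ring
    have h2 : ∀ U ∈ F.powerset, c + ∑ i ∈ insert j F, (if i ∈ insert j U then 1 else -1) * f i =
        (c + f j) + ∑ i ∈ F, (if i ∈ U then 1 else -1) * f i := fun U _ => by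
      rw [Finset.sum_insert hj, if_pos (Finset.mem_insert_self j U), one_mul, add_assoc]
      congr 2
      refine Finset.sum_congr rfl fun i hi => ?_
      have : i ≠ j := fun h => hj (h ▸ hi)
      simp [this]
    rw [Finset.sum_congr rfl fun U hU => congrArg abs (h1 U hU),
      Finset.sum_congr rfl fun U hU => congrArg abs (h2 U hU)]
    have h3 := ih (c - f j)
    have h4 := ih (c + f j)
    have h5 : 2 * |c| ≤ |c - f j| + |c + f j| := by
      have := abs_add_le (c - f j) (c + f j)
      rw [show c - f j + (c + f j) = 2 * c by ring, abs_mul, abs_two] at this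
      exact this
    have h6 : (0 : ℝ) < 2 ^ F.card := by positivity
    rw [pow_succ]
    nlinarith

theorem le_sum_powerset_abs_of_mem {ι : Type*} [DecidableEq ι] (f : ι → ℝ) {F : Finset ι} {j : ι}
    (hj : j ∈ F) :
    2 ^ F.card * |f j| ≤ ∑ U ∈ F.powerset, |∑ i ∈ F, (if i ∈ U then 1 else -1) * f i| := by
  obtain ⟨F, hjF, rfl⟩ : ∃ E, j ∉ E ∧ insert j E = F :=
    ⟨F.erase j, Finset.notMem_erase j F, Finset.insert_erase hj⟩
  rw [Finset.sum_powerset_insert hjF, Finset.card_insert_of_notMem hjF]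
  have h1 : ∀ U ∈ F.powerset, ∑ i ∈ insert j F, (if i ∈ U then 1 else -1) * f i =
      (- f j) + ∑ i ∈ F, (if i ∈ U then 1 else -1) * f i := fun U hU => by
    rw [Finset.sum_insert hjF, if_neg fun h => hjF (Finset.mem_powerset.1 hU h)]
    ring
  have h2 : ∀ U ∈ F.powerset, ∑ i ∈ insert j F, (if i ∈ insert j U then 1 else -1) * f i =
      f j + ∑ i ∈ F, (if i ∈ U then 1 else -1) * f i := fun U _ => by
    rw [Finset.sum_insert hjF, if_pos (Finset.mem_insert_self j U), one_mul]
    congr 1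
    refine Finset.sum_congr rfl fun i hi => ?_
    have : i ≠ j := fun h => hjF (h ▸ hi)
    simp [this]
  rw [Finset.sum_congr rfl fun U hU => congrArg abs (h1 U hU),
    Finset.sum_congr rfl fun U hU => congrArg abs (h2 U hU)]
  have h3 := le_sum_powerset_abs f F (-f j)
  have h4 := le_sum_powerset_abs f F (f j)
  rw [abs_neg] at h3
  rw [pow_succ]
  linarith

theorem schreierCoord_eq_zero_of_notMem {ξ : ℕ} {M : Set ℕ+} {n : ℕ+} (hn : n ∉ M)
    (z : schreierSubspace ξ M) : schreierCoord ξ n z = 0 := by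
  have h : schreierSubspace ξ M ≤ LinearMap.ker (schreierCoord ξ n).toLinearMap := by
    refine Submodule.topologicalClosure_minimal _ (Submodule.span_le.2 ?_)
      (schreierCoord ξ n).isClosed_ker
    rintro _ ⟨k, hk, rfl⟩
    have : k ≠ n := fun h => hn (h ▸ hk)
    simp [schreierCoord_basis, this]
  exact h z.2

/-- Each choice of signs on `F` is a functional of norm at most one, and the average over signs of
the absolute value of its composition with `T` still sees the single coordinate `k i`. -/
theorem preimageNorming_of_operator {ξ : ℕ} {l m : ℕ → ℕ+} (hl : StrictMono l)
    (hm : StrictMono m) {Y : Submodule ℝ (SchreierSpace ξ)}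
    (T : schreierSubspace ξ (Set.range l) →L[ℝ] Y) {δ : ℝ}
    (hδ : 0 < δ) {k : ℕ → ℕ} (hk : ∀ i, δ < |schreierCoord ξ (m (k i))
      (T (schreierSubBasis ξ (Set.range l) ⟨l i, i, rfl⟩) : SchreierSpace ξ)|) :
    PreimageNorming (fun i => (l i : ℕ)) (fun i => (m i : ℕ)) k ξ (‖T‖ / δ) := by
  classical
  intro F hF G hG x B hx hB
  set e : ℕ → schreierSubspace ξ (Set.range l) :=
    fun i => schreierSubBasis ξ (Set.range l) ⟨l i, i, rfl⟩ with he
  set t : ℕ → ℕ → ℝ := fun i j => schreierCoord ξ (m j) (T (e i) : SchreierSpace ξ) with ht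
  set φ : Finset ℕ → ℕ → ℝ := fun U i => ∑ j ∈ F, (if j ∈ U then 1 else -1) * t i j with hφ
  have hU : ∀ U, ∑ i ∈ G, x i * |φ U i| ≤ ‖T‖ * B := by
    intro U
    -- The signs of `φ U i` turn the pairing of `T y` with the sign pattern `U` into a sum of
    -- absolute values; they do not increase the norm.
    set y := ∑ i ∈ G, (x i * SignType.sign (φ U i)) • e i with hy
    have hsign : ∀ s : SignType, |(s : ℝ)| ≤ 1 := fun s => by cases s <;> simp
    have hnorm : ‖y‖ ≤ B := by
      have : (y : SchreierSpace ξ) =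
          ∑ i ∈ G, (x i * SignType.sign (φ U i)) • schreierBasis ξ (l i) := by
        simp [hy, he, schreierSubBasis]
      rw [Submodule.coe_norm, this]
      refine norm_sum_basis_le hl fun A hA hS => le_trans (Finset.sum_le_sum fun i _ => ?_)
        (hB A hA hS)
      rw [abs_mul, abs_of_nonneg (hx i)]
      exact mul_le_of_le_one_right (hx i) (hsign _)
    have hcoord : ∀ j, schreierCoord ξ (m j) (T y : SchreierSpace ξ) =
        ∑ i ∈ G, x i * SignType.sign (φ U i) * t i j := fun j => by
      simp [hy, ht, map_sum]
    calc ∑ i ∈ G, x i * |φ U i|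
        = ∑ j ∈ F, (if j ∈ U then 1 else -1) * schreierCoord ξ (m j) (T y : SchreierSpace ξ) := by
          simp only [hcoord, Finset.mul_sum]
          rw [Finset.sum_comm]
          refine Finset.sum_congr rfl fun i _ => ?_
          rw [← sign_mul_self (φ U i)]
          nth_rw 2 [hφ]
          simp only [Finset.mul_sum]
          exact Finset.sum_congr rfl fun j _ => by ring
      _ ≤ ∑ j ∈ F, |schreierCoord ξ (m j) (T y : SchreierSpace ξ)| :=
          Finset.sum_le_sum fun j _ => by
            split_ifs
            · rw [one_mul]; exact le_abs_self _
            · rw [neg_one_mul]; exact neg_le_abs _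
      _ = ∑ n ∈ F.image m, |schreierCoord ξ n (T y : SchreierSpace ξ)| := by
          rw [Finset.sum_image fun _ _ _ _ h => hm.injective h]
      _ ≤ ‖T y‖ := sum_abs_schreierCoord_le (hF.image_mem_schreierFamily hm) _
      _ ≤ ‖T‖ * ‖y‖ := T.le_opNorm y
      _ ≤ ‖T‖ * B := mul_le_mul_of_nonneg_left hnorm T.opNorm_nonneg
  have h2 : (0 : ℝ) < 2 ^ F.card := by positivity
  have key : 2 ^ F.card * (δ * ∑ i ∈ G, x i) ≤ 2 ^ F.card * (‖T‖ * B) := by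
    calc 2 ^ F.card * (δ * ∑ i ∈ G, x i) = ∑ i ∈ G, x i * (2 ^ F.card * δ) := by
          rw [← Finset.sum_mul]; ring
      _ ≤ ∑ i ∈ G, x i * ∑ U ∈ F.powerset, |φ U i| :=
          Finset.sum_le_sum fun i hi => mul_le_mul_of_nonneg_left
            ((mul_le_mul_of_nonneg_left (hk i).le h2.le).trans
              (le_sum_powerset_abs_of_mem (t i) (hG i hi))) (hx i)
      _ = ∑ U ∈ F.powerset, ∑ i ∈ G, x i * |φ U i| := by
          simp only [Finset.mul_sum]
          exact Finset.sum_comm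
      _ ≤ F.powerset.card • (‖T‖ * B) := Finset.sum_le_card_nsmul _ _ _ fun U _ => hU U
      _ = 2 ^ F.card * (‖T‖ * B) := by simp [Finset.card_powerset]
  rw [div_mul_eq_mul_div, le_div_iff₀ hδ, mul_comm]
  exact le_of_mul_le_mul_left key h2

theorem denseRange_linearCombination_subBasis (ξ : ℕ) (l : ℕ → ℕ+) :
    DenseRange (Finsupp.linearCombination ℝ
      fun i => schreierSubBasis ξ (Set.range l) ⟨l i, i, rfl⟩) := by
  intro z
  rw [closure_subtype]
  refine closure_mono ?_ z.2
  intro y hy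
  rw [← Set.range_comp] at hy
  obtain ⟨a, rfl⟩ := Finsupp.mem_span_range_iff_exists_finsupp.1 hy
  exact ⟨_, ⟨a, rfl⟩, by simp [Finsupp.linearCombination_apply, Finsupp.sum, schreierSubBasis]⟩

theorem coe_linearCombination_subBasis (ξ : ℕ) (l : ℕ → ℕ+) (a : ℕ →₀ ℝ) :
    ((Finsupp.linearCombination ℝ
      (fun i => schreierSubBasis ξ (Set.range l) ⟨l i, i, rfl⟩) a : schreierSubspace ξ _) :
        SchreierSpace ξ) =
      ∑ i ∈ Finset.range (a.support.sup id + 1), a i • schreierBasis ξ (l i) := by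
  rw [Finsupp.linearCombination_apply, Finsupp.sum_of_support_subset (s := Finset.range
    (a.support.sup id + 1))]
  · simp [schreierSubBasis]
  · exact fun i hi => Finset.mem_range.2 (Nat.lt_succ_of_le (Finset.le_sup (f := id) hi))
  · simp

theorem exists_operator_of_dominates {ξ : ℕ} {l m : ℕ → ℕ+}
    (h : Dominates (fun n => schreierBasis ξ (l n)) (fun n => schreierBasis ξ (m n))) :
    ∃ T : schreierSubspace ξ (Set.range l) →L[ℝ] schreierSubspace ξ (Set.range m),
      ∀ i, T (schreierSubBasis ξ (Set.range l) ⟨l i, i, rfl⟩) =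
        schreierSubBasis ξ (Set.range m) ⟨m i, i, rfl⟩ := by
  obtain ⟨C, -, hC⟩ := h
  have : CompleteSpace (schreierSubspace ξ (Set.range m)) :=
    (Submodule.isClosed_topologicalClosure _).completeSpace_coe
  -- Domination is exactly boundedness on finite combinations, which are dense in the domain; the
  -- closed target subspace is complete.
  refine ⟨LinearMap.extendOfNorm
    (Finsupp.linearCombination ℝ fun i => schreierSubBasis ξ (Set.range m) ⟨m i, i, rfl⟩)
    (Finsupp.linearCombination ℝ fun i => schreierSubBasis ξ (Set.range l) ⟨l i, i, rfl⟩),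
    fun i => ?_⟩
  have := LinearMap.extendOfNorm_eq (denseRange_linearCombination_subBasis ξ l)
    (f := Finsupp.linearCombination ℝ fun i => schreierSubBasis ξ (Set.range m) ⟨m i, i, rfl⟩)
    ⟨C, fun a => by
      rw [Submodule.coe_norm, Submodule.coe_norm, coe_linearCombination_subBasis,
        coe_linearCombination_subBasis]
      exact hC _ a⟩ (Finsupp.single i 1)
  simpa using this

/-! ### The equivalence. -/

theorem theorem1 (ξ : ℕ) (L M : Set ℕ+) (l m : ℕ → ℕ+)
    (hl : StrictMono l) (hL : Set.range l = L)
    (hm : StrictMono m) (hM : Set.range m = M) :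
    List.TFAE [
      ∃ (T : schreierSubspace ξ L →L[ℝ] schreierSubspace ξ M) (δ : ℝ), 0 < δ ∧
        ∀ k : L, δ < schreierSupNorm ξ (T (schreierSubBasis ξ L k) : SchreierSpace ξ),
      ∀ ζ ≤ ξ, Dominates (fun n => schreierBasis ζ (l n)) (fun n => schreierBasis ζ (m n)),
      Dominates (fun n => schreierBasis ξ (l n)) (fun n => schreierBasis ξ (m n))] := by
  subst hL hM
  have hlt : ∀ {w : ℕ → ℕ+}, StrictMono w → StrictMono fun i => (w i : ℕ) :=
    fun hw i j hij => hw hij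
  have hgt : ∀ {w : ℕ → ℕ+}, StrictMono w → ∀ i, i < (w i : ℕ) := fun {w} hw i => by
    induction i with
    | zero => exact (w 0).pos
    | succ i ih => exact Nat.lt_of_le_of_lt ih (hlt hw (Nat.lt_succ_self i))
  tfae_have 2 → 3 := fun h => h ξ le_rfl
  tfae_have 3 → 1 := fun h => by
    obtain ⟨T, hT⟩ := exists_operator_of_dominates h
    refine ⟨T, 1 / 2, by norm_num, ?_⟩
    rintro ⟨_, i, rfl⟩
    rw [hT i]
    refine lt_of_lt_of_le (by norm_num : (1 : ℝ) / 2 < 1)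
      (le_trans (le_of_eq ?_) (le_ciSup (bddAbove_schreierSupNorm ξ _) (m i)))
    simp [schreierSubBasis, schreierCoord_basis]
  tfae_have 1 → 2 := by
    rintro ⟨T, δ, hδ, hT⟩ ζ hζ
    -- Coordinates outside the range of `m` vanish on the target, so one exceeding `δ` has the form
    -- `m k`.
    have hk : ∀ i, ∃ k, δ < |schreierCoord ξ (m k)
        (T (schreierSubBasis ξ (Set.range l) ⟨l i, i, rfl⟩) : SchreierSpace ξ)| := fun i => by
      obtain ⟨n, hn⟩ := exists_lt_of_lt_ciSup (hT ⟨l i, i, rfl⟩)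
      by_cases hnm : n ∈ Set.range m
      · obtain ⟨k, rfl⟩ := hnm
        exact ⟨k, hn⟩
      · rw [schreierCoord_eq_zero_of_notMem hnm, abs_zero] at hn
        exact absurd hn hδ.not_gt
    choose k hk using hk
    have hP := preimageNorming_of_operator hl hm T hδ hk
    obtain ⟨C, hC⟩ := PreimageNorming.ascend (hlt hl).monotone (hgt hl) (hlt hm).monotone
      fun e he => hP.descend_le (hlt hl).monotone (hgt hl) (hgt hm) (he.trans hζ)
    exact dominates_of_isNorming hl hm hC
  tfae_finish
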